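/- **Setting.** Let $X_1,X_2,\dots$ be random elements of a measurable space $\Xi$ on a probability space $(\Omega,\mathcal F,P)$, and write $\mathbf X_n=(X_1,\dots,X_n)$. Let $\boldsymbol\Theta=\prod_k\Theta_k$ (finitely or infinitely many factors) carry a $\sigma$-algebra $\mathcal T$ and a prior probability measure $\pi$, and for each $\theta\in\boldsymbol\Theta$ let $F_\theta$ be a probability law on sequences in $\Xi$. For each $n$ let the true law of $\mathbf X_n$ and all its laws under $F_\theta$ have densities $p$ and $f_\theta$ with respect to a common reference measure; the true law need not be among the $F_\theta$. Put $R_n(\theta)=f_\theta(\mathbf X_n)/p(\mathbf X_n)$, let $\pi(A\mid\mathbf X_n)=\int_A f_\theta(\mathbf X_n)\,d\pi/\int f_\theta(\mathbf X_n)\,d\pi$ be the posterior, and $$h(\theta)=\lim_{n}\tfrac1n E\log\frac{p(\mathbf X_n)}{f_\theta(\mathbf X_n)}\in[0,\infty],\quad h(A)=\operatorname*{ess\,inf}_{\theta\in A}h(\theta),\quad J(\theta)=h(\theta)-h(\boldsymbol\Theta),\quad J(A)=\operatorname*{ess\,inf}_{\theta\in A}J(\theta),$$ the essential infima being with respect to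 $\pi$. Let $I=\{h=\infty\}$. **Standing assumptions.** (S1) $R_n(\theta)$ is $\sigma(\mathbf X_n)\otimes\mathcal T$-measurable for every $n$. (S2) For every $\theta$, $\frac1n\log R_n(\theta)\to-h(\theta)$ almost surely. (S3) The limit $h(\theta)$ exists for every $\theta$ (possibly infinite), and $h$ is $\mathcal T$-measurable. (S4) $\pi(I)<1$. There are sets $\mathcal G_n\in\mathcal T$ with $\mathcal G_n\to\boldsymbol\Theta$ (each $\theta$ lies in all but finitely many $\mathcal G_n$) such that: (S5) (1) $\pi(\mathcal G_n)\ge1-\alpha e^{-\varsigma n}$ for all $n$, for some $\alpha>0$ and $\varsigma>2h(\boldsymbol\Theta)$; (2) almost surely $\sup_{\theta\in\mathcal G_n\setminus I}\left|\frac1n\log R_n(\theta)+h(\theta)\right|\to0$ and, if $\pi(I)>0$, also $\operatorname*{ess\,sup}_{\theta\in\mathcal G_n\cap I}\frac1n\log R_n(\theta)\to-\infty$ (essential supremum with respect to $\pi$); (3) $h(\mathcal G_n)\to h(\boldsymbol\Theta)$. (S6) For measurable $A$ and $\delta>0$ let $\tau(A,\delta)$ be the least (random) time such that $\frac1k\log\int_AR_k\,d\pi\le\delta+\limsup_j\frac1j\log\int_AR_j\,d\pi$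 for all $k>\tau(A,\delta)$. For every $\delta>0$, almost surely $n>\tau(\mathcal G_n,\delta)$ for all sufficiently large $n$. (S7) $h(\mathcal G_n\cap A)\to h(A)$ for every $A\in\mathcal T$ with $\pi(A)>0$. **Hypotheses and procedure.** For $i=1,\dots,m$ test $H_{0i}:\theta_i\in\Theta_{0i}$ against $H_{1i}:\theta_i\in\Theta_{1i}=\Theta_i\setminus\Theta_{0i}$, where the event $\{\theta_i\in\Theta_{0i}\}$ is in $\mathcal T$; we also write $H_{0i},H_{1i}$ for the corresponding subsets of $\boldsymbol\Theta$. Let $G_i\subseteq\{1,\dots,m\}$ be arbitrary groups with $i\in G_i$. For a decision configuration $d\in\{0,1\}^m$ put $$\boldsymbol\Theta(d)=\bigcap_{i=1}^m H_{d_ii},\quad \boldsymbol\Theta_{id}=H_{1i}\cap\bigcap_{j\in G_i,\,j\ne i}H_{d_jj},\quad w_{in}(d)=\pi(\boldsymbol\Theta_{id}\mid\mathbf X_n),\quad v_{in}=\pi(H_{1i}\mid\mathbf X_n).$$ The true configuration $d^t$ is the unique $d$ with $J(\boldsymbol\Theta(d))=J(\boldsymbol\Theta)$. Given $\beta_n\in(0,1)$,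 the non-marginal procedure chooses, on the data $\mathbf X_n$, a configuration $\widehat d_n$ that maximizes $\sum_{i=1}^m d_i\,(w_{in}(d)-\beta_n)$ over $d\in\{0,1\}^m$ (ties broken arbitrarily). Writing $\widehat d=\widehat d_n$, its posterior error rates are $$mFDR_{\mathbf X_n}=\frac{\sum_i\widehat d_i\,(1-w_{in}(\widehat d))}{(\sum_i\widehat d_i)\vee1},\qquad FDR_{\mathbf X_n}=\frac{\sum_i\widehat d_i\,(1-v_{in})}{(\sum_i\widehat d_i)\vee1}.$$ **Theorem.** Assume (S1)-(S7), that $\varsigma>2\min_{i:d^t_i=1}h(H_{0i})$, and (A1) $\liminf_n\beta_n>0$ and $\limsup_n\beta_n<1$; (A2) $d^t\ne(0,\dots,0)$ and $d^t\ne(1,\dots,1)$. Let $J_{\min}=\min_{i:d^t_i=1}J(\boldsymbol\Theta_{id^t}^c)$ and $H_{\min}=\min_{i:d^t_i=1}J(H_{0i})$. Then, almost surely, $$\lim_{n\to\infty}\frac1n\log mFDR_{\mathbf X_n}=-J_{\min}\qquad\text{and}\qquad\lim_{n\to\infty}\frac1n\log FDR_{\mathbf X_n}=-H_{\min}.$$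 -/

import Mathlib

open MeasureTheory Filter Topology
open scoped ENNReal

noncomputable section

/-- A Bayesian model for a data process.  `P` is the true law on `Ω`, `X j` is the `(j+1)`-st
observation, `F θ` is the postulated law of the whole process under the parameter `θ`, `prior` is
the prior.  For every sample size `n` the true law of the first `n` observations and all the
postulated ones are dominated by a common reference measure `ref n`, with densities `p n` and
`f n θ`.  The true law need not be one of the postulated laws. -/
structure BayesModel (Ω Ξ Θ : Type*) [MeasurableSpace Ω] [MeasurableSpace Ξ]
    [MeasurableSpace Θ] where
  P : Measure Ω
  isProb_P : IsProbabilityMeasure P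
  X : ℕ → Ω → Ξ
  measurable_X : ∀ j, Measurable (X j)
  F : Θ → Measure (ℕ → Ξ)
  isProb_F : ∀ θ, IsProbabilityMeasure (F θ)
  prior : Measure Θ
  isProb_prior : IsProbabilityMeasure prior
  ref : (n : ℕ) → Measure (Fin n → Ξ)
  p : (n : ℕ) → (Fin n → Ξ) → ℝ≥0∞
  f : (n : ℕ) → Θ → (Fin n → Ξ) → ℝ≥0∞
  measurable_p : ∀ n, Measurable (p n)
  measurable_f : ∀ n θ, Measurable (f n θ)
  density_p : ∀ n, P.map (fun ω (j : Fin n) => X j ω) = (ref n).withDensity (p n)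
  density_f : ∀ n θ, (F θ).map (fun s (j : Fin n) => s j) = (ref n).withDensity (f n θ)

namespace BayesModel

section Basic

variable {Ω Ξ Θ : Type*} [MeasurableSpace Ω] [MeasurableSpace Ξ] [MeasurableSpace Θ]
  (B : BayesModel Ω Ξ Θ)

/-- The data of size `n`: the first `n` observations. -/
def data (n : ℕ) (ω : Ω) : Fin n → Ξ := fun j => B.X j ω

/-- The likelihood ratio `R_n(θ)` as a function of the data. -/
def R (n : ℕ) (θ : Θ) (x : Fin n → Ξ) : ℝ≥0∞ := B.f n θ x / B.p n x

/-- `n⁻¹ log R_n(θ)` at the sample point `ω`. -/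
def avgLogR (n : ℕ) (θ : Θ) (ω : Ω) : EReal := ENNReal.log (B.R n θ (B.data n ω)) / (n : EReal)

/-- The Kullback-Leibler divergence of the true law of the first `n` observations from the one
postulated under `θ`, that is `E log (p(X_n) / f_θ(X_n))`, possibly infinite. -/
def kl (n : ℕ) (θ : Θ) : ℝ≥0∞ :=
  InformationTheory.klDiv (B.P.map (B.data n)) ((B.F θ).map (fun s (j : Fin n) => s j))

/-- The KL-divergence rate.  It is written as a limsup in order to be defined for every model;
`ShaliziConditions.s3_lim` says that it is a limit. -/
def h (θ : Θ) : ℝ≥0∞ := limsup (fun n : ℕ => B.kl n θ / (n : ℝ≥0∞)) atTop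

/-- `h(A)`, the essential infimum of `h` over `A` with respect to the prior. -/
def hSet (A : Set Θ) : EReal := essInf (fun θ => (B.h θ : EReal)) (B.prior.restrict A)

/-- `J(θ) = h(θ) - h(Θ)`. -/
def J (θ : Θ) : EReal := (B.h θ : EReal) - B.hSet Set.univ

/-- `J(A)`, the essential infimum of `J` over `A` with respect to the prior. -/
def JSet (A : Set Θ) : EReal := essInf B.J (B.prior.restrict A)

/-- The parameters at infinite divergence rate from the truth. -/
def infSet : Set Θ := {θ | B.h θ = ∞}

/-- `n⁻¹ log ∫_A R_n(θ) π(dθ)` at the sample point `ω`. -/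
def avgLogInt (A : Set Θ) (n : ℕ) (ω : Ω) : EReal :=
  ENNReal.log (∫⁻ θ in A, B.R n θ (B.data n ω) ∂B.prior) / (n : EReal)

/-- `τ(A, δ)` at the sample point `ω`: the least time after which `n⁻¹ log ∫_A R_n dπ` exceeds its
upper limit by at most `δ` (`⊤` if there is none). -/
def tau (A : Set Θ) (δ : ℝ) (ω : Ω) : ℕ∞ :=
  sInf {N : ℕ∞ | ∀ k : ℕ, N < (k : ℕ∞) →
    B.avgLogInt A k ω ≤ (δ : EReal) + limsup (fun j => B.avgLogInt A j ω) atTop}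

/-- The posterior probability of `A` given the data `x`, by Bayes' formula. -/
def post (n : ℕ) (x : Fin n → Ξ) (A : Set Θ) : ℝ≥0∞ :=
  (∫⁻ θ in A, B.f n θ x ∂B.prior) / ∫⁻ θ, B.f n θ x ∂B.prior

/-- Shalizi's conditions (S1)-(S7), with sieve `G` and prior mass exponent `ς`. -/
structure ShaliziConditions (G : ℕ → Set Θ) (ς : ℝ) : Prop where
  /-- (S1): `R_n(θ)` is measurable with respect to the product of `σ(X_1, …, X_n)` and the
  `σ`-algebra of the parameter space. -/
  s1 : ∀ n : ℕ, @Measurable (Ω × Θ) ℝ≥0∞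
    ((MeasurableSpace.comap (B.data n) inferInstance).prod inferInstance) inferInstance
    (fun q => B.R n q.2 (B.data n q.1))
  /-- (S2): the generalized asymptotic equipartition property. -/
  s2 : ∀ θ, ∀ᵐ ω ∂B.P, Tendsto (fun n => B.avgLogR n θ ω) atTop (𝓝 (-(B.h θ : EReal)))
  /-- (S3): the KL-divergence rate exists as a limit, possibly infinite. -/
  s3_lim : ∀ θ, Tendsto (fun n : ℕ => B.kl n θ / (n : ℝ≥0∞)) atTop (𝓝 (B.h θ))
  /-- (S3): the KL-divergence rate is measurable. -/
  s3_meas : Measurable B.h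
  /-- (S4) -/
  s4 : B.prior B.infSet < 1
  /-- (S5): the sets `G n` are measurable. -/
  s5_meas : ∀ n, MeasurableSet (G n)
  /-- (S5): `G n → Θ`. -/
  s5_tendsto : ∀ θ, ∀ᶠ n in atTop, θ ∈ G n
  /-- (S5)(1): the prior mass outside the sieve. -/
  s5_mass : ∃ α : ℝ, 0 < α ∧ ∀ n : ℕ, 1 - α * Real.exp (-(ς * n)) ≤ (B.prior (G n)).toReal
  /-- (S5)(1): the size of the exponent. -/
  s5_exp : 2 * B.hSet Set.univ < (ς : EReal)
  /-- (S5)(2): almost surely, the equipartition property is uniform over `G n \ I`. -/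
  s5_unif : ∀ᵐ ω ∂B.P, ∀ ε : ℝ, 0 < ε → ∀ᶠ n in atTop, ∀ θ ∈ G n \ B.infSet,
    -(B.h θ : EReal) - (ε : EReal) ≤ B.avgLogR n θ ω ∧
      B.avgLogR n θ ω ≤ -(B.h θ : EReal) + (ε : EReal)
  /-- (S5)(2): almost surely, the divergence to `-∞` is uniform over `G n ∩ I`, up to sets of
  prior measure zero (void if `I` has prior probability zero). -/
  s5_unif_inf : ∀ᵐ ω ∂B.P, ∀ K : ℝ, ∀ᶠ n in atTop, ∀ᵐ θ ∂B.prior.restrict (G n ∩ B.infSet),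
    B.avgLogR n θ ω ≤ ((-K : ℝ) : EReal)
  /-- (S5)(3) -/
  s5_h : Tendsto (fun n => B.hSet (G n)) atTop (𝓝 (B.hSet Set.univ))
  /-- (S6) -/
  s6 : ∀ δ : ℝ, 0 < δ → ∀ᵐ ω ∂B.P, ∀ᶠ n : ℕ in atTop, B.tau (G n) δ ω < (n : ℕ∞)
  /-- (S7) -/
  s7 : ∀ A : Set Θ, MeasurableSet A → 0 < B.prior A →
    Tendsto (fun n => B.hSet (G n ∩ A)) atTop (𝓝 (B.hSet A))

end Basic

section Testing

/-! Multiple testing.  The parameter is `θ = (θ_k)_k`, with `k` in an arbitrary (possibly infinite)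
index type; the `i`-th of the `m` hypotheses concerns the coordinate `θ_{e i}`, with null set
`Θ₀ i` and alternative set the complement of `Θ₀ i`.  A decision configuration is a
`d : Fin m → Bool`, where `d i = true` means that the `i`-th null hypothesis is rejected. -/

variable {κ : Type*} {S : κ → Type*} {m : ℕ} (e : Fin m ↪ κ) (Θ₀ : (i : Fin m) → Set (S (e i)))

/-- `H_{0i}` for `b = false`, `H_{1i}` for `b = true`, as a subset of the parameter space. -/
def hyp (i : Fin m) (b : Bool) : Set (∀ k, S k) :=
  if b = true then {θ | θ (e i) ∉ Θ₀ i} else {θ | θ (e i) ∈ Θ₀ i}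

/-- `Θ(d)`: the parameters for which every decision in `d` is correct. -/
def configSet (d : Fin m → Bool) : Set (∀ k, S k) := {θ | ∀ i, θ ∈ hyp e Θ₀ i (d i)}

/-- `Θ_{id}`: `H_{1i}` holds and so does `H_{d_j, j}` for all the other `j` in the group of `i`;
the remaining coordinates are free. -/
def groupSet (Gr : Fin m → Finset (Fin m)) (i : Fin m) (d : Fin m → Bool) : Set (∀ k, S k) :=
  {θ | θ ∈ hyp e Θ₀ i true ∧ ∀ j ∈ Gr i, j ≠ i → θ ∈ hyp e Θ₀ j (d j)}

variable {Ω Ξ : Type*} [MeasurableSpace Ω] [MeasurableSpace Ξ] [MeasurableSpace (∀ k, S k)]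
  (B : BayesModel Ω Ξ (∀ k, S k))

/-- `dt` is the true decision configuration: the one at which the minimal divergence `J(Θ)` from
the truth is attained. -/
def IsTrueConfig (dt : Fin m → Bool) : Prop :=
  B.JSet (configSet e Θ₀ dt) = B.JSet Set.univ ∧
    ∀ d, d ≠ dt → B.JSet Set.univ < B.JSet (configSet e Θ₀ d)

/-- `w_{in}(d)` -/
def w (Gr : Fin m → Finset (Fin m)) (n : ℕ) (x : Fin n → Ξ) (i : Fin m) (d : Fin m → Bool) :
    ℝ≥0∞ :=
  B.post n x (groupSet e Θ₀ Gr i d)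

/-- `v_{in}` -/
def v (n : ℕ) (x : Fin n → Ξ) (i : Fin m) : ℝ≥0∞ := B.post n x (hyp e Θ₀ i true)

/-- The criterion `∑ i, d_i (w_{in}(d) - β)` of the non-marginal procedure. -/
def criterion (Gr : Fin m → Finset (Fin m)) (β : ℝ) (n : ℕ) (x : Fin n → Ξ)
    (d : Fin m → Bool) : ℝ :=
  ∑ i, if d i = true then (B.w e Θ₀ Gr n x i d).toReal - β else 0

/-- `dhat n x` is the decision taken on the data `x` of size `n`; the rule is non-marginal with
penalties `β n` if it always maximizes the criterion over all decision configurations (ties are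
broken in any way). -/
def IsNonMarginal (Gr : Fin m → Finset (Fin m)) (β : ℕ → ℝ)
    (dhat : (n : ℕ) → (Fin n → Ξ) → (Fin m → Bool)) : Prop :=
  ∀ n x d, B.criterion e Θ₀ Gr (β n) n x d ≤ B.criterion e Θ₀ Gr (β n) n x (dhat n x)

/-- `δ(d | x)` for the non-randomized rule `dhat`: the indicator of `d` being chosen. -/
def delta (dhat : (n : ℕ) → (Fin n → Ξ) → (Fin m → Bool)) (n : ℕ) (x : Fin n → Ξ)
    (d : Fin m → Bool) : ℝ≥0∞ :=
  if dhat n x = d then 1 else 0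

/-- The modified posterior false discovery rate of the rule `dhat` given the data `x`. -/
def mFDR (Gr : Fin m → Finset (Fin m)) (dhat : (n : ℕ) → (Fin n → Ξ) → (Fin m → Bool))
    (n : ℕ) (x : Fin n → Ξ) : ℝ≥0∞ :=
  ∑ d : Fin m → Bool,
    (∑ i, if d i = true then 1 - B.w e Θ₀ Gr n x i d else 0) /
      max (∑ i, if d i = true then 1 else 0) 1 * delta dhat n x d

/-- The posterior false discovery rate of the rule `dhat` given the data `x`. -/
def FDR (dhat : (n : ℕ) → (Fin n → Ξ) → (Fin m → Bool)) (n : ℕ) (x : Fin n → Ξ) : ℝ≥0∞ :=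
  ∑ d : Fin m → Bool,
    (∑ i, if d i = true then 1 - B.v e Θ₀ n x i else 0) /
      max (∑ i, if d i = true then 1 else 0) 1 * delta dhat n x d

/-- `J_min`, the minimum of `J(Θ_{i dt}ᶜ)` over the `i` with `dt i = 1`. -/
def Jmin (Gr : Fin m → Finset (Fin m)) (dt : Fin m → Bool) : EReal :=
  (Finset.univ.filter fun i => dt i = true).inf fun i => B.JSet (groupSet e Θ₀ Gr i dt)ᶜ

/-- `H_min`, the minimum of `J(H_{0i})` over the `i` with `dt i = 1`. -/
def Hmin (dt : Fin m → Bool) : EReal :=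
  (Finset.univ.filter fun i => dt i = true).inf fun i => B.JSet (hyp e Θ₀ i false)

end Testing

end BayesModel

end

/-!
The whole argument is about the exponential rate of posterior probabilities.  Fix a sample point at
which the assumptions that hold almost surely are in force (`BayesModel.IsRegularPoint`,
`BayesModel.ShaliziConditions.ae_isRegularPoint`); one null set then serves for all sets `A`.

* Inside the sieve `G n` the likelihood ratio is `exp (-n h(θ))` up to a uniform subexponential
  error.  Outside, `E R_n(θ) ≤ 1`, Fubini and the prior mass bound give
  `E ∫_{(G n)ᶜ} R_n dπ ≤ α exp (-ς n)`, hence the same rate almost surely.  So `∫_A R_n dπ` decays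
  at rate at least `min (h(A), ς)` (`IsRegularPoint.eventually_setLIntegral_R_le`), and at rate at
  most `h(A)` because a part of `A` of positive prior mass with divergence rate near `h(A)` is
  contained in the sieves from some time on (`IsRegularPoint.eventually_le_setLIntegral_R`).
* Dividing by the case `A = Θ`, the posterior probability of `A` decays at rate `J(A)`, as long as
  this is less than `ς - h(Θ)`.
* Every set of parameters that contradicts a true decision has `J > 0`
  (`IsTrueConfig.JSet_pos`), so all posterior probabilities in the criterion tend to the true
  values `0` and `1`, and as the penalties stay away from `0` and `1` the procedure eventually takes
  the true decisions (`IsRegularPoint.eventually_dhat_eq`).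
* From then on both error rates are averages, over the true rejections `i`, of the posterior
  probabilities of `Θ_{i dt}ᶜ` and of `H_{0i}`; an average decays at the smallest of the rates of
  its terms (`IsRegularPoint.tendsto_log_average_post`).  The condition on `ς` puts that
  smallest rate below `ς - h(Θ)`.
-/

/-! ### Exponential decay -/

/-- The sequence `exp (-c n)`, as an extended nonnegative real. -/
noncomputable def expDecay (c : ℝ) (n : ℕ) : ℝ≥0∞ := ENNReal.ofReal (Real.exp (-(c * n)))

lemma expDecay_ne_zero (c : ℝ) (n : ℕ) : expDecay c n ≠ 0 := by
  simp [expDecay, Real.exp_pos]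

lemma expDecay_ne_top (c : ℝ) (n : ℕ) : expDecay c n ≠ ∞ := ENNReal.ofReal_ne_top

lemma expDecay_add (a b : ℝ) (n : ℕ) : expDecay (a + b) n = expDecay a n * expDecay b n := by
  rw [expDecay, expDecay, expDecay, ← ENNReal.ofReal_mul (Real.exp_pos _).le, ← Real.exp_add]
  ring_nf

lemma expDecay_sub (a b : ℝ) (n : ℕ) : expDecay (a - b) n = expDecay a n / expDecay b n := by
  rw [ENNReal.eq_div_iff (expDecay_ne_zero b n) (expDecay_ne_top b n), ← expDecay_add]
  ring_nf

lemma expDecay_anti {a b : ℝ} (hab : a ≤ b) (n : ℕ) : expDecay b n ≤ expDecay a n := by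
  apply ENNReal.ofReal_le_ofReal
  gcongr

lemma tendsto_expDecay {c : ℝ} (hc : 0 < c) : Tendsto (expDecay c) atTop (𝓝 0) := by
  have h : Tendsto (fun n : ℕ => Real.exp (-(c * n))) atTop (𝓝 0) :=
    Real.tendsto_exp_neg_atTop_nhds_zero.comp
      (tendsto_natCast_atTop_atTop.const_mul_atTop hc)
  have h' := ENNReal.tendsto_ofReal h
  rwa [ENNReal.ofReal_zero] at h'

/-- A constant factor is absorbed by any loss in the exponent. -/
lemma eventually_const_mul_expDecay_le {K : ℝ≥0∞} (hK : K ≠ ∞) {a b : ℝ} (hab : a < b) :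
    ∀ᶠ n in atTop, K * expDecay b n ≤ expDecay a n := by
  have h : Tendsto (fun n => K * expDecay (b - a) n) atTop (𝓝 0) := by
    simpa using ENNReal.Tendsto.const_mul (tendsto_expDecay (sub_pos.2 hab)) (Or.inr hK)
  filter_upwards [h.eventually (gt_mem_nhds zero_lt_one)] with n hn
  calc K * expDecay b n = K * expDecay (b - a) n * expDecay a n := by
        rw [mul_assoc, ← expDecay_add]; ring_nf
    _ ≤ 1 * expDecay a n := by gcongr
    _ = expDecay a n := one_mul _

lemma eventually_expDecay_le_const_mul {q : ℝ≥0∞} (hq : q ≠ 0) {a b : ℝ} (hab : a < b) :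
    ∀ᶠ n in atTop, expDecay b n ≤ q * expDecay a n := by
  by_cases hq' : q = ∞
  · refine Eventually.of_forall fun n => ?_
    simp [hq', ENNReal.top_mul (expDecay_ne_zero a n)]
  filter_upwards [eventually_const_mul_expDecay_le (ENNReal.inv_ne_top.2 hq) hab] with n hn
  calc expDecay b n = q * (q⁻¹ * expDecay b n) := by
        rw [← mul_assoc, ENNReal.mul_inv_cancel hq hq', one_mul]
    _ ≤ q * expDecay a n := by gcongr

lemma tsum_expDecay_ne_top {c : ℝ} (hc : 0 < c) : ∑' n, expDecay c n ≠ ∞ := by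
  have h : Summable fun n : ℕ => Real.exp (-(c * n)) := by
    have := Real.summable_exp_nat_mul_iff.2 (neg_neg_of_pos hc)
    refine this.congr fun n => ?_
    congr 1; ring
  exact h.tsum_ofReal_ne_top

lemma log_expDecay (c : ℝ) (n : ℕ) : ENNReal.log (expDecay c n) = ((-c : ℝ) : EReal) * n := by
  rw [expDecay, ENNReal.log_ofReal_of_pos (Real.exp_pos _), Real.log_exp]
  rw [← EReal.coe_coe_eq_natCast, ← EReal.coe_mul]
  ring_nf

lemma log_div_le_iff {u : ℝ≥0∞} {c : ℝ} {n : ℕ} (hn : 0 < n) :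
    ENNReal.log u / (n : EReal) ≤ ((-c : ℝ) : EReal) ↔ u ≤ expDecay c n := by
  rw [EReal.div_le_iff_le_mul (by exact_mod_cast hn) (EReal.natCast_ne_top n), mul_comm,
    ← log_expDecay, ENNReal.log_le_log_iff]

lemma le_log_div_iff {u : ℝ≥0∞} {c : ℝ} {n : ℕ} (hn : 0 < n) :
    ((-c : ℝ) : EReal) ≤ ENNReal.log u / (n : EReal) ↔ expDecay c n ≤ u := by
  rw [EReal.le_div_iff_mul_le (by exact_mod_cast hn) (EReal.natCast_ne_top n),
    ← log_expDecay, ENNReal.log_le_log_iff]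

/-- Two-sided exponential bounds at all rates below and above `M` amount to
`n⁻¹ log u_n → -M`. -/
lemma tendsto_log_div_of_expDecay {u : ℕ → ℝ≥0∞} {M : EReal}
    (hupper : ∀ x : ℝ, (x : EReal) < M → ∀ᶠ n in atTop, u n ≤ expDecay x n)
    (hlower : ∀ x : ℝ, M < x → ∀ᶠ n in atTop, expDecay x n ≤ u n) :
    Tendsto (fun n : ℕ => ENNReal.log (u n) / (n : EReal)) atTop (𝓝 (-M)) := by
  refine tendsto_order.2 ⟨fun b hb => ?_, fun b hb => ?_⟩
  · obtain ⟨x, hMx, hxb⟩ := EReal.lt_iff_exists_real_btwn.1 (EReal.lt_neg_comm.1 hb)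
    filter_upwards [hlower x hMx, eventually_gt_atTop 0] with n hn hn0
    refine lt_of_lt_of_le ?_ ((le_log_div_iff hn0).2 hn)
    rw [EReal.coe_neg]
    exact EReal.lt_neg_comm.1 hxb
  · obtain ⟨x, hbx, hxM⟩ := EReal.lt_iff_exists_real_btwn.1 (EReal.neg_lt_comm.1 hb)
    filter_upwards [hupper x hxM, eventually_gt_atTop 0] with n hn hn0
    refine lt_of_le_of_lt ((log_div_le_iff hn0).2 hn) ?_
    rw [EReal.coe_neg]
    exact EReal.neg_lt_comm.1 hbx

namespace BayesModel

section Posterior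

variable {Ω Ξ Θ : Type*} [MeasurableSpace Ω] [MeasurableSpace Ξ] [MeasurableSpace Θ]
  {B : BayesModel Ω Ξ Θ}

/-! ### Essential infima of the divergence rate -/

lemma le_essInf_iff_ae {α : Type*} [MeasurableSpace α] {μ : Measure α} {g : α → EReal}
    {c : EReal} : c ≤ essInf g μ ↔ ∀ᵐ x ∂μ, c ≤ g x :=
  ⟨fun hc => (ae_essInf_le (f := g) (μ := μ)).mono fun _ hx => hc.trans hx,
    fun hc => le_essInf_of_ae_le c hc⟩

lemma hSet_nonneg (A : Set Θ) : 0 ≤ B.hSet A :=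
  le_essInf_iff_ae.2 (Eventually.of_forall fun _ => EReal.coe_ennreal_nonneg _)

lemma hSet_anti {A A' : Set Θ} (hA : A ⊆ A') : B.hSet A' ≤ B.hSet A :=
  le_essInf_iff_ae.2 ((le_essInf_iff_ae.1 le_rfl).filter_mono
    (ae_mono (Measure.restrict_mono hA le_rfl)))

lemma two_mul_coe_lt_coe_iff {a b : ℝ} : 2 * (a : EReal) < b ↔ 2 * a < b := by
  rw [show (2 : EReal) = ((2 : ℝ) : EReal) from rfl, ← EReal.coe_mul, EReal.coe_lt_coe_iff]

/-- By (S4), the divergence rate of the whole parameter space is finite; being nonnegative, it is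
less than `ς` as soon as its double is. -/
lemma ShaliziConditions.exists_hSet_univ_eq {G : ℕ → Set Θ} {ς : ℝ}
    (hS : B.ShaliziConditions G ς) : ∃ a : ℝ, a < ς ∧ B.hSet Set.univ = a := by
  have htop : B.hSet Set.univ ≠ ⊤ := by
    intro h
    have h1 : ∀ᵐ θ ∂B.prior, ⊤ ≤ (B.h θ : EReal) := by
      have := le_essInf_iff_ae.1 h.ge
      rwa [Measure.restrict_univ] at this
    have := B.isProb_prior
    have h2 : B.prior B.infSet = 1 := by
      rw [← measure_univ (μ := B.prior)]
      refine measure_congr (eventuallyEq_univ.2 ?_)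
      filter_upwards [h1] with θ hθ
      exact EReal.coe_ennreal_eq_top_iff.1 (top_le_iff.1 hθ)
    exact hS.s4.ne h2
  have h0 := B.hSet_nonneg Set.univ
  have hlt := hS.s5_exp
  lift B.hSet Set.univ to ℝ using ⟨htop, (EReal.bot_lt_zero.trans_le h0).ne'⟩ with a
  have ha0 : 0 ≤ a := by exact_mod_cast h0
  have := two_mul_coe_lt_coe_iff.1 hlt
  exact ⟨a, by linarith, rfl⟩

lemma JSet_eq {a : ℝ} (ha : B.hSet Set.univ = a) (A : Set Θ) : B.JSet A = B.hSet A - a := by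
  refine eq_of_forall_le_iff fun c => ?_
  have key : ∀ y : EReal, c ≤ y - (a : EReal) ↔ c + a ≤ y := fun y =>
    EReal.le_sub_iff_add_le (Or.inl (EReal.coe_ne_bot a)) (Or.inl (EReal.coe_ne_top a))
  rw [key, JSet, hSet, le_essInf_iff_ae, le_essInf_iff_ae]
  simp only [J, ha, key]

lemma lt_JSet_iff {a : ℝ} (ha : B.hSet Set.univ = a) (A : Set Θ) (x : ℝ) :
    (x : EReal) < B.JSet A ↔ ((x + a : ℝ) : EReal) < B.hSet A := by
  rw [JSet_eq ha, EReal.lt_sub_iff_add_lt (Or.inl (EReal.coe_ne_bot a))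
    (Or.inl (EReal.coe_ne_top a)), EReal.coe_add]

lemma JSet_lt_iff {a : ℝ} (ha : B.hSet Set.univ = a) (A : Set Θ) (x : ℝ) :
    B.JSet A < x ↔ B.hSet A < ((x + a : ℝ) : EReal) := by
  rw [JSet_eq ha, EReal.sub_lt_iff (Or.inl (EReal.coe_ne_bot a))
    (Or.inl (EReal.coe_ne_top a)), EReal.coe_add]

/-! ### Sample points at which the likelihood ratios are regular -/

/-- The sample point `ω` is regular: the true density of the data is positive and finite there,
the prior mass outside the sieve contributes to `∫ R_n dπ` no more than its exponential rate `ς`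
predicts, and the equipartition property holds uniformly over the sieve.  The condition on the
density excludes the junk values of the quotient `R_n`. -/
structure IsRegularPoint (B : BayesModel Ω Ξ Θ) (G : ℕ → Set Θ) (ς : ℝ) (ω : Ω) : Prop where
  p_ne_zero : ∀ n, B.p n (B.data n ω) ≠ 0
  p_ne_top : ∀ n, B.p n (B.data n ω) ≠ ∞
  tail : ∀ c < ς, ∀ᶠ n in atTop,
    ∫⁻ θ in (G n)ᶜ, B.R n θ (B.data n ω) ∂B.prior ≤ expDecay c n
  unif : ∀ ε : ℝ, 0 < ε → ∀ᶠ n in atTop, ∀ θ ∈ G n \ B.infSet,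
    -(B.h θ : EReal) - (ε : EReal) ≤ B.avgLogR n θ ω ∧
      B.avgLogR n θ ω ≤ -(B.h θ : EReal) + (ε : EReal)
  unif_inf : ∀ K : ℝ, ∀ᶠ n in atTop, ∀ᵐ θ ∂B.prior.restrict (G n ∩ B.infSet),
    B.avgLogR n θ ω ≤ ((-K : ℝ) : EReal)

lemma measurable_data (n : ℕ) : Measurable (B.data n) :=
  measurable_pi_lambda _ fun j => B.measurable_X j

lemma ae_p_ne_zero (n : ℕ) : ∀ᵐ ω ∂B.P, B.p n (B.data n ω) ≠ 0 := by
  have hm : MeasurableSet {x | B.p n x = 0} := B.measurable_p n (measurableSet_singleton 0)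
  have h : B.P.map (B.data n) {x | B.p n x = 0} = 0 := by
    refine (congrArg (fun μ => μ {x | B.p n x = 0}) (B.density_p n)).trans ?_
    rw [withDensity_apply _ hm, setLIntegral_congr_fun hm (g := fun _ => 0) (fun x hx => hx)]
    simp
  rw [Measure.map_apply (measurable_data n) hm] at h
  exact measure_eq_zero_iff_ae_notMem.1 h

lemma ae_p_ne_top (n : ℕ) : ∀ᵐ ω ∂B.P, B.p n (B.data n ω) ≠ ∞ := by
  have := B.isProb_P
  have hP : IsProbabilityMeasure (B.P.map (B.data n)) :=
    Measure.isProbabilityMeasure_map (measurable_data n).aemeasurable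
  have hd : B.P.map (B.data n) = (B.ref n).withDensity (B.p n) := B.density_p n
  have hint : ∫⁻ x, B.p n x ∂B.ref n ≠ ∞ := by
    rw [← setLIntegral_univ, ← withDensity_apply _ MeasurableSet.univ, ← hd]
    exact measure_ne_top _ _
  have h : ∀ᵐ x ∂B.P.map (B.data n), B.p n x < ∞ := by
    rw [hd]
    exact (withDensity_absolutelyContinuous _ _).ae_le (ae_lt_top (B.measurable_p n) hint)
  exact (ae_of_ae_map (measurable_data n).aemeasurable h).mono fun _ hx => hx.ne

/-- The likelihood ratio has expectation at most one under the true law. -/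
lemma lintegral_R_le_one (n : ℕ) (θ : Θ) : ∫⁻ ω, B.R n θ (B.data n ω) ∂B.P ≤ 1 := by
  have := B.isProb_F θ
  have hR : Measurable (B.R n θ) := (B.measurable_f n θ).div (B.measurable_p n)
  have hd : B.P.map (B.data n) = (B.ref n).withDensity (B.p n) := B.density_p n
  have hF : IsProbabilityMeasure ((B.F θ).map (fun s (j : Fin n) => s j)) :=
    Measure.isProbabilityMeasure_map
      (measurable_pi_lambda _ fun j => measurable_pi_apply _).aemeasurable
  rw [← lintegral_map hR (measurable_data n), hd,
    lintegral_withDensity_eq_lintegral_mul _ (B.measurable_p n) hR]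
  calc ∫⁻ x, (B.p n * B.R n θ) x ∂B.ref n ≤ ∫⁻ x, B.f n θ x ∂B.ref n := by
        refine lintegral_mono fun x => ?_
        exact ENNReal.mul_div_le
    _ = (B.F θ).map (fun s (j : Fin n) => s j) Set.univ := by
        rw [B.density_f, withDensity_apply _ MeasurableSet.univ, setLIntegral_univ]
    _ = 1 := measure_univ

lemma ShaliziConditions.measurable_R_prod {G : ℕ → Set Θ} {ς : ℝ}
    (hS : B.ShaliziConditions G ς) (n : ℕ) :
    Measurable (fun q : Ω × Θ => B.R n q.2 (B.data n q.1)) := by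
  refine (hS.s1 n).mono ?_ le_rfl
  refine sup_le_sup (MeasurableSpace.comap_mono ?_) le_rfl
  exact (measurable_data n).comap_le

/-- Outside the sieve, the expectation of `∫ R_n dπ` is at most the prior mass there. -/
lemma ShaliziConditions.lintegral_tail_le {G : ℕ → Set Θ} {ς : ℝ}
    (hS : B.ShaliziConditions G ς) (n : ℕ) :
    ∫⁻ ω, ∫⁻ θ in (G n)ᶜ, B.R n θ (B.data n ω) ∂B.prior ∂B.P ≤ B.prior (G n)ᶜ := by
  have := B.isProb_P
  have := B.isProb_prior
  rw [lintegral_lintegral_swap (hS.measurable_R_prod n).aemeasurable]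
  calc _ ≤ ∫⁻ _ in (G n)ᶜ, 1 ∂B.prior := lintegral_mono fun θ => lintegral_R_le_one n θ
    _ = _ := by simp

lemma ShaliziConditions.exists_prior_compl_le {G : ℕ → Set Θ} {ς : ℝ}
    (hS : B.ShaliziConditions G ς) :
    ∃ K : ℝ≥0∞, K ≠ ∞ ∧ ∀ n, B.prior (G n)ᶜ ≤ K * expDecay ς n := by
  have := B.isProb_prior
  obtain ⟨α, hα, hmass⟩ := hS.s5_mass
  refine ⟨ENNReal.ofReal α, ENNReal.ofReal_ne_top, fun n => ?_⟩
  rw [expDecay, ← ENNReal.ofReal_mul hα.le, ← ofReal_measureReal,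
    probReal_compl_eq_one_sub (hS.s5_meas n)]
  refine ENNReal.ofReal_le_ofReal ?_
  have := hmass n
  rw [measureReal_def]
  linarith

lemma ShaliziConditions.ae_tail_le {G : ℕ → Set Θ} {ς : ℝ}
    (hS : B.ShaliziConditions G ς) {c : ℝ} (hc : c < ς) :
    ∀ᵐ ω ∂B.P, ∀ᶠ n in atTop,
      ∫⁻ θ in (G n)ᶜ, B.R n θ (B.data n ω) ∂B.prior ≤ expDecay c n := by
  have := B.isProb_prior
  obtain ⟨K, hK, hmass⟩ := hS.exists_prior_compl_le
  have hmeas : ∀ n, Measurable fun ω => ∫⁻ θ in (G n)ᶜ, B.R n θ (B.data n ω) ∂B.prior :=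
    fun n => (hS.measurable_R_prod n).lintegral_prod_right'
  -- a series of nonnegative terms with finite expectation has terms tending to zero almost surely
  have hsum : ∫⁻ ω, ∑' n, expDecay (-c) n *
      ∫⁻ θ in (G n)ᶜ, B.R n θ (B.data n ω) ∂B.prior ∂B.P ≠ ∞ := by
    rw [lintegral_tsum fun n => ((hmeas n).const_mul _).aemeasurable]
    refine ne_top_of_le_ne_top (ENNReal.mul_ne_top hK (tsum_expDecay_ne_top (sub_pos.2 hc))) ?_
    rw [← ENNReal.tsum_mul_left]
    refine ENNReal.tsum_le_tsum fun n => ?_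
    rw [lintegral_const_mul _ (hmeas n)]
    calc _ ≤ expDecay (-c) n * (K * expDecay ς n) := by
          gcongr
          exact (hS.lintegral_tail_le n).trans (hmass n)
      _ = K * expDecay (ς - c) n := by
          rw [mul_left_comm, ← expDecay_add]; ring_nf
  filter_upwards [ae_lt_top (Measurable.tsum fun n => (hmeas n).const_mul _) hsum] with ω hω
  have := ENNReal.tendsto_atTop_zero_of_tsum_ne_top hω.ne
  filter_upwards [this.eventually (gt_mem_nhds zero_lt_one)] with n hn
  calc _ = expDecay c n * (expDecay (-c) n *
        ∫⁻ θ in (G n)ᶜ, B.R n θ (B.data n ω) ∂B.prior) := by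
        rw [← mul_assoc, ← expDecay_add]; simp [expDecay]
    _ ≤ expDecay c n * 1 := by gcongr
    _ = _ := mul_one _

theorem ShaliziConditions.ae_isRegularPoint {G : ℕ → Set Θ} {ς : ℝ}
    (hS : B.ShaliziConditions G ς) : ∀ᵐ ω ∂B.P, B.IsRegularPoint G ς ω := by
  -- rates `c` along a sequence increasing to `ς` suffice, so that one null set serves for all `c`
  have htail : ∀ᵐ ω ∂B.P, ∀ k : ℕ, ∀ᶠ n in atTop,
      ∫⁻ θ in (G n)ᶜ, B.R n θ (B.data n ω) ∂B.prior ≤ expDecay (ς - 1 / (k + 1)) n :=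
    ae_all_iff.2 fun k => hS.ae_tail_le (sub_lt_self _ Nat.one_div_pos_of_nat)
  filter_upwards [ae_all_iff.2 fun n => B.ae_p_ne_zero n, ae_all_iff.2 fun n => B.ae_p_ne_top n,
    htail, hS.s5_unif, hS.s5_unif_inf] with ω h1 h2 h3 h4 h5
  refine ⟨h1, h2, fun c hc => ?_, h4, h5⟩
  obtain ⟨k, hk⟩ := exists_nat_one_div_lt (sub_pos.2 hc)
  filter_upwards [h3 k] with n hn
  exact hn.trans (expDecay_anti (by linarith) n)

/-! ### Exponential rates of integrated likelihood ratios -/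

/-- The integral over `A` splits into the part inside the sieve, where the uniform equipartition
property bounds the integrand by a rate just below `h(A)`, and the part outside, whose rate
is at least `ς`. -/
theorem IsRegularPoint.eventually_setLIntegral_R_le {G : ℕ → Set Θ} {ς : ℝ}
    (hS : B.ShaliziConditions G ς) {ω : Ω} (hω : B.IsRegularPoint G ς ω) {A : Set Θ}
    (hA : MeasurableSet A) {c : ℝ} (hcς : c < ς) (hcA : (c : EReal) < B.hSet A) :
    ∀ᶠ n in atTop, ∫⁻ θ in A, B.R n θ (B.data n ω) ∂B.prior ≤ expDecay c n := by
  have := B.isProb_prior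
  obtain ⟨c₂, hc₂, hc₂'⟩ :=
    EReal.lt_iff_exists_real_btwn.1 (lt_min hcA (EReal.coe_lt_coe_iff.2 hcς))
  have hcc₂ : c < c₂ := EReal.coe_lt_coe_iff.1 hc₂
  have hc₂ς : c₂ < ς := EReal.coe_lt_coe_iff.1 (hc₂'.trans_le (min_le_right _ _))
  have hc₂A : (c₂ : EReal) ≤ B.hSet A := hc₂'.le.trans (min_le_left _ _)
  obtain ⟨c₁, hcc₁, hc₁₂⟩ := exists_between hcc₂
  have hI : MeasurableSet B.infSet := hS.s3_meas (measurableSet_singleton _)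
  filter_upwards [hω.tail c₁ (hc₁₂.trans hc₂ς), hω.unif (c₂ - c₁) (sub_pos.2 hc₁₂),
    hω.unif_inf c₁, eventually_gt_atTop 0,
    eventually_const_mul_expDecay_le (K := 2) (by simp) hcc₁] with n h1 h2 h3 hn0 h4
  have hGm := hS.s5_meas n
  have hin : ∀ᵐ θ ∂B.prior.restrict (G n ∩ A), B.R n θ (B.data n ω) ≤ expDecay c₁ n := by
    have h5 : ∀ᵐ θ ∂B.prior, θ ∈ A → (c₂ : EReal) ≤ B.h θ :=
      (ae_restrict_iff' hA).1 (le_essInf_iff_ae.1 hc₂A)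
    rw [ae_restrict_iff' (hGm.inter hI)] at h3
    rw [ae_restrict_iff' (hGm.inter hA)]
    filter_upwards [h3, h5] with θ hθ3 hθ5 hθ
    rw [← log_div_le_iff hn0]
    by_cases hθI : θ ∈ B.infSet
    · exact hθ3 ⟨hθ.1, hθI⟩
    · refine (h2 θ ⟨hθ.1, hθI⟩).2.trans ?_
      calc -(B.h θ : EReal) + ((c₂ - c₁ : ℝ) : EReal)
          ≤ -(c₂ : EReal) + ((c₂ - c₁ : ℝ) : EReal) := by
            gcongr
            exact EReal.neg_le_neg_iff.2 (hθ5 hθ.2)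
        _ = ((-c₁ : ℝ) : EReal) := by
            rw [← EReal.coe_neg, ← EReal.coe_add]; ring_nf
  calc ∫⁻ θ in A, B.R n θ (B.data n ω) ∂B.prior
      ≤ ∫⁻ θ in G n ∩ A ∪ (G n)ᶜ, B.R n θ (B.data n ω) ∂B.prior :=
        lintegral_mono_set fun θ hθ => by
          by_cases h : θ ∈ G n
          · exact Or.inl ⟨h, hθ⟩
          · exact Or.inr h
    _ ≤ (∫⁻ θ in G n ∩ A, B.R n θ (B.data n ω) ∂B.prior) +
          ∫⁻ θ in (G n)ᶜ, B.R n θ (B.data n ω) ∂B.prior := lintegral_union_le _ _ _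
    _ ≤ expDecay c₁ n + expDecay c₁ n := by
        refine add_le_add ?_ h1
        calc _ ≤ ∫⁻ _ in G n ∩ A, expDecay c₁ n ∂B.prior := lintegral_mono_ae hin
          _ = expDecay c₁ n * B.prior (G n ∩ A) := setLIntegral_const _ _
          _ ≤ expDecay c₁ n * 1 := by gcongr; exact prob_le_one
          _ = _ := mul_one _
    _ = 2 * expDecay c₁ n := (two_mul _).symm
    _ ≤ expDecay c n := h4

/-- The parameters of `A` at divergence rate less than `c₀`, for some `c₀` between `h(A)` and `c`,
have positive prior mass; a subset of positive mass lies in the sieve from some time on, and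
there the uniform equipartition property bounds the integrand from below. -/
theorem IsRegularPoint.eventually_le_setLIntegral_R {G : ℕ → Set Θ} {ς : ℝ}
    (hS : B.ShaliziConditions G ς) {ω : Ω} (hω : B.IsRegularPoint G ς ω) {A : Set Θ}
    (hA : MeasurableSet A) {c : ℝ} (hcA : B.hSet A < c) :
    ∀ᶠ n in atTop, expDecay c n ≤ ∫⁻ θ in A, B.R n θ (B.data n ω) ∂B.prior := by
  obtain ⟨c₀, hc₀A, hc₀⟩ := EReal.lt_iff_exists_real_btwn.1 hcA
  obtain ⟨c₁, hc₀₁, hc₁⟩ := exists_between (EReal.coe_lt_coe_iff.1 hc₀)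
  have hhm : Measurable fun θ => (B.h θ : EReal) := hS.s3_meas.coe_ereal_ennreal
  set A' : Set Θ := A ∩ {θ | (B.h θ : EReal) < c₀} with hA'
  have hA'm : MeasurableSet A' := hA.inter (measurableSet_lt hhm measurable_const)
  have hpos : B.prior A' ≠ 0 := by
    intro h0
    refine hc₀A.not_ge (le_essInf_iff_ae.2 ((ae_restrict_iff' hA).2 ?_))
    filter_upwards [measure_eq_zero_iff_ae_notMem.1 h0] with θ hθ hθA
    exact not_lt.1 fun hlt => hθ ⟨hθA, hlt⟩
  obtain ⟨N, hN⟩ : ∃ N, B.prior (A' ∩ ⋂ n ≥ N, G n) ≠ 0 := by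
    by_contra! hall
    refine hpos (measure_mono_null (fun θ hθ => ?_) (measure_iUnion_null hall))
    obtain ⟨N, hN⟩ := eventually_atTop.1 (hS.s5_tendsto θ)
    exact Set.mem_iUnion.2 ⟨N, hθ, Set.mem_iInter₂.2 hN⟩
  set E : Set Θ := A' ∩ ⋂ n ≥ N, G n with hE
  have hEm : MeasurableSet E :=
    hA'm.inter (MeasurableSet.iInter fun n => MeasurableSet.iInter fun _ => hS.s5_meas n)
  filter_upwards [hω.unif (c₁ - c₀) (sub_pos.2 hc₀₁), eventually_gt_atTop 0,
    eventually_ge_atTop N, eventually_expDecay_le_const_mul hN hc₁] with n h2 hn0 hnN h4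
  calc expDecay c n ≤ B.prior E * expDecay c₁ n := h4
    _ = ∫⁻ _ in E, expDecay c₁ n ∂B.prior := by rw [setLIntegral_const, mul_comm]
    _ ≤ ∫⁻ θ in E, B.R n θ (B.data n ω) ∂B.prior := by
        refine setLIntegral_mono' hEm fun θ hθ => ?_
        have hθc : (B.h θ : EReal) < c₀ := hθ.1.2
        have hθI : θ ∉ B.infSet := fun hI => by
          rw [show B.h θ = ∞ from hI] at hθc
          exact not_top_lt hθc
        rw [← le_log_div_iff hn0]
        refine le_trans ?_ (h2 θ ⟨Set.mem_iInter₂.1 hθ.2 n hnN, hθI⟩).1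
        calc ((-c₁ : ℝ) : EReal) = -(c₀ : EReal) - ((c₁ - c₀ : ℝ) : EReal) := by
              rw [← EReal.coe_neg, ← EReal.coe_sub]; ring_nf
          _ ≤ _ := EReal.sub_le_sub (EReal.neg_le_neg_iff.2 hθc.le) le_rfl
    _ ≤ _ := lintegral_mono_set fun θ hθ => hθ.1.1

/-! ### Exponential rates of posterior probabilities -/

lemma post_mono (n : ℕ) (x : Fin n → Ξ) {A A' : Set Θ} (hA : A ⊆ A') :
    B.post n x A ≤ B.post n x A' :=
  ENNReal.div_le_div_right (lintegral_mono_set hA) _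

lemma post_le_one (n : ℕ) (x : Fin n → Ξ) (A : Set Θ) : B.post n x A ≤ 1 :=
  (ENNReal.div_le_div_right (setLIntegral_le_lintegral _ _) _).trans ENNReal.div_self_le_one

/-- The posterior in terms of likelihood ratios: the true density cancels. -/
lemma IsRegularPoint.post_eq {G : ℕ → Set Θ} {ς : ℝ} {ω : Ω} (hω : B.IsRegularPoint G ς ω)
    (n : ℕ) (A : Set Θ) :
    B.post n (B.data n ω) A = (∫⁻ θ in A, B.R n θ (B.data n ω) ∂B.prior) /
      ∫⁻ θ, B.R n θ (B.data n ω) ∂B.prior := by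
  have hp0 := hω.p_ne_zero n
  have hpt := hω.p_ne_top n
  have hf : ∀ θ, B.f n θ (B.data n ω) = B.R n θ (B.data n ω) * B.p n (B.data n ω) := fun θ =>
    (ENNReal.div_mul_cancel hp0 hpt).symm
  simp only [post, hf]
  rw [lintegral_mul_const' _ _ hpt, lintegral_mul_const' _ _ hpt,
    ENNReal.mul_div_mul_right _ _ hp0 hpt]

/-- The posterior is eventually a probability measure: the normalizing constant is positive and
finite. -/
lemma IsRegularPoint.eventually_one_sub_post {G : ℕ → Set Θ} {ς : ℝ}
    (hS : B.ShaliziConditions G ς) {ω : Ω} (hω : B.IsRegularPoint G ς ω) :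
    ∀ᶠ n in atTop, ∀ A, MeasurableSet A →
      1 - B.post n (B.data n ω) A = B.post n (B.data n ω) Aᶜ := by
  obtain ⟨a, haς, ha⟩ := hS.exists_hSet_univ_eq
  filter_upwards [hω.eventually_setLIntegral_R_le hS MeasurableSet.univ (c := a - 1)
      (by linarith) (by rw [ha]; exact EReal.coe_lt_coe_iff.2 (by linarith)),
    hω.eventually_le_setLIntegral_R hS MeasurableSet.univ (c := a + 1)
      (by rw [ha]; exact EReal.coe_lt_coe_iff.2 (by linarith))] with n h1 h2 A hA
  rw [setLIntegral_univ] at h1 h2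
  have hZt := ne_top_of_le_ne_top (expDecay_ne_top _ n) h1
  have hZ0 : ∫⁻ θ, B.R n θ (B.data n ω) ∂B.prior ≠ 0 :=
    ((pos_iff_ne_zero.2 (expDecay_ne_zero _ n)).trans_le h2).ne'
  have hsum : B.post n (B.data n ω) Aᶜ + B.post n (B.data n ω) A = 1 := by
    rw [hω.post_eq, hω.post_eq, ← ENNReal.add_div, add_comm, lintegral_add_compl _ hA,
      ENNReal.div_self hZ0 hZt]
  rw [← hsum]
  exact ENNReal.add_sub_cancel_right
    (ne_top_of_le_ne_top ENNReal.one_ne_top (post_le_one _ _ _))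

theorem IsRegularPoint.eventually_post_le {G : ℕ → Set Θ} {ς : ℝ}
    (hS : B.ShaliziConditions G ς) {ω : Ω} (hω : B.IsRegularPoint G ς ω) {a : ℝ}
    (ha : B.hSet Set.univ = a) {A : Set Θ} (hA : MeasurableSet A) {x : ℝ} (hxς : x < ς - a)
    (hxA : (x : EReal) < B.JSet A) :
    ∀ᶠ n in atTop, B.post n (B.data n ω) A ≤ expDecay x n := by
  rw [lt_JSet_iff ha] at hxA
  obtain ⟨c, hc, hc'⟩ := EReal.lt_iff_exists_real_btwn.1
    (lt_min hxA (EReal.coe_lt_coe_iff.2 (show x + a < ς by linarith)))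
  have hcς : c < ς := EReal.coe_lt_coe_iff.1 (hc'.trans_le (min_le_right _ _))
  have hxc : x + a < c := EReal.coe_lt_coe_iff.1 hc
  filter_upwards [hω.eventually_setLIntegral_R_le hS hA hcς (hc'.trans_le (min_le_left _ _)),
    hω.eventually_le_setLIntegral_R hS MeasurableSet.univ (c := c - x)
      (by rw [ha]; exact EReal.coe_lt_coe_iff.2 (by linarith))] with n h1 h2
  rw [setLIntegral_univ] at h2
  rw [hω.post_eq, show x = c - (c - x) by ring, expDecay_sub]
  exact ENNReal.div_le_div h1 h2

theorem IsRegularPoint.eventually_le_post {G : ℕ → Set Θ} {ς : ℝ}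
    (hS : B.ShaliziConditions G ς) {ω : Ω} (hω : B.IsRegularPoint G ς ω) {A : Set Θ}
    (hA : MeasurableSet A) {x : ℝ} (hxA : B.JSet A < x) :
    ∀ᶠ n in atTop, expDecay x n ≤ B.post n (B.data n ω) A := by
  obtain ⟨a, haς, ha⟩ := hS.exists_hSet_univ_eq
  rw [JSet_lt_iff ha] at hxA
  obtain ⟨c, hc, hc'⟩ := EReal.lt_iff_exists_real_btwn.1 hxA
  have hcx : c < x + a := EReal.coe_lt_coe_iff.1 hc'
  filter_upwards [hω.eventually_le_setLIntegral_R hS hA hc,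
    hω.eventually_setLIntegral_R_le hS MeasurableSet.univ (c := c - x)
      (by linarith) (by rw [ha]; exact EReal.coe_lt_coe_iff.2 (by linarith))] with n h1 h2
  rw [setLIntegral_univ] at h2
  rw [hω.post_eq, show x = c - (c - x) by ring, expDecay_sub]
  exact ENNReal.div_le_div h1 h2

/-- The average of finitely many posterior probabilities decays at the smallest of their rates,
provided that this rate is less than the one guaranteed for the complement of the sieve. -/
theorem IsRegularPoint.tendsto_log_average_post {G : ℕ → Set Θ} {ς : ℝ}
    (hS : B.ShaliziConditions G ς) {ω : Ω} (hω : B.IsRegularPoint G ς ω) {a : ℝ}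
    (ha : B.hSet Set.univ = a) {ι : Type*} {D : Finset ι} (hD : D.Nonempty) {A : ι → Set Θ}
    (hA : ∀ i, MeasurableSet (A i))
    (hM : D.inf (fun i => B.JSet (A i)) < ((ς - a : ℝ) : EReal)) {u : ℕ → ℝ≥0∞}
    (hu : ∀ᶠ n in atTop, u n = (∑ i ∈ D, B.post n (B.data n ω) (A i)) / (D.card : ℝ≥0∞)) :
    Tendsto (fun n : ℕ => ENNReal.log (u n) / (n : EReal)) atTop
      (𝓝 (-(D.inf fun i => B.JSet (A i)))) := by
  have hcard : (D.card : ℝ≥0∞) ≠ 0 := by exact_mod_cast hD.card_ne_zero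
  have hcard' : (D.card : ℝ≥0∞) ≠ ∞ := ENNReal.natCast_ne_top _
  refine tendsto_log_div_of_expDecay (fun x hx => ?_) fun x hx => ?_
  · have hxς : x < ς - a := EReal.coe_lt_coe_iff.1 (hx.trans hM)
    have hall : ∀ᶠ n in atTop, ∀ i ∈ D, B.post n (B.data n ω) (A i) ≤ expDecay x n :=
      (Finset.eventually_all D).2 fun i hi => hω.eventually_post_le hS ha (hA i) hxς
        (hx.trans_le (Finset.inf_le hi))
    filter_upwards [hu, hall] with n hn h
    rw [hn]
    refine ENNReal.div_le_of_le_mul ?_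
    calc _ ≤ ∑ _i ∈ D, expDecay x n := Finset.sum_le_sum h
      _ = _ := by rw [Finset.sum_const, nsmul_eq_mul, mul_comm]
  · obtain ⟨i, hi, hiM⟩ := Finset.exists_mem_eq_inf D hD fun i => B.JSet (A i)
    rw [hiM] at hx
    obtain ⟨y, hy, hyx⟩ := EReal.lt_iff_exists_real_btwn.1 hx
    filter_upwards [hu, hω.eventually_le_post hS (hA i) hy,
      eventually_expDecay_le_const_mul (ENNReal.inv_ne_zero.2 hcard')
        (EReal.coe_lt_coe_iff.1 hyx)] with n hn h1 h2
    rw [hn, ENNReal.div_eq_inv_mul]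
    refine h2.trans ?_
    gcongr
    exact h1.trans (Finset.single_le_sum (f := fun i => B.post n (B.data n ω) (A i))
      (fun _ _ => zero_le) hi)

lemma IsRegularPoint.eventually_post_le_const {G : ℕ → Set Θ} {ς : ℝ}
    (hS : B.ShaliziConditions G ς) {ω : Ω} (hω : B.IsRegularPoint G ς ω) {A : Set Θ}
    (hA : MeasurableSet A) (hJ : 0 < B.JSet A) {ε : ℝ≥0∞} (hε : 0 < ε) :
    ∀ᶠ n in atTop, B.post n (B.data n ω) A ≤ ε := by
  obtain ⟨a, haς, ha⟩ := hS.exists_hSet_univ_eq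
  obtain ⟨x, hx0, hx⟩ := EReal.lt_iff_exists_real_btwn.1
    (lt_min hJ (show (0 : EReal) < ((ς - a : ℝ) : EReal) by exact_mod_cast sub_pos.2 haς))
  filter_upwards [hω.eventually_post_le hS ha hA
      (EReal.coe_lt_coe_iff.1 (hx.trans_le (min_le_right _ _))) (hx.trans_le (min_le_left _ _)),
    (tendsto_expDecay (by exact_mod_cast hx0 : (0 : ℝ) < x)).eventually (gt_mem_nhds hε)]
    with n h1 h2
  exact h1.trans h2.le

end Posterior

section Testing

/-! ### Hypotheses and decision configurations -/

variable {κ : Type*} {S : κ → Type*} {m : ℕ} {e : Fin m ↪ κ} {Θ₀ : (i : Fin m) → Set (S (e i))}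
  {dt : Fin m → Bool}

lemma mem_hyp_iff {i : Fin m} {b : Bool} {θ : ∀ k, S k} :
    θ ∈ hyp e Θ₀ i b ↔ (b = true ↔ θ (e i) ∉ Θ₀ i) := by
  cases b <;> simp [hyp]

lemma compl_hyp (i : Fin m) (b : Bool) : (hyp e Θ₀ i b)ᶜ = hyp e Θ₀ i (!b) := by
  ext θ
  cases b <;> simp [hyp]

lemma groupSet_subset_hyp (Gr : Fin m → Finset (Fin m)) (i : Fin m) (d : Fin m → Bool) :
    groupSet e Θ₀ Gr i d ⊆ hyp e Θ₀ i true := fun _ hθ => hθ.1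

lemma configSet_subset_groupSet (Gr : Fin m → Finset (Fin m)) {i : Fin m} {d : Fin m → Bool}
    (hi : d i = true) : configSet e Θ₀ d ⊆ groupSet e Θ₀ Gr i d :=
  fun _ hθ => ⟨hi ▸ hθ i, fun j _ _ => hθ j⟩

/-- The common form of both error rates: a rule that takes the decisions `dt` has as its rate the
average of the individual error probabilities over the rejected hypotheses. -/
lemma sum_errorRate_mul_delta {Ξ : Type*} {dhat : (n : ℕ) → (Fin n → Ξ) → (Fin m → Bool)} {n : ℕ}
    {x : Fin n → Ξ} (hx : dhat n x = dt) (hne : (Finset.univ.filter fun i => dt i = true).Nonempty)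
    (q : Fin m → (Fin m → Bool) → ℝ≥0∞) :
    ∑ d : Fin m → Bool, (∑ i, if d i = true then 1 - q i d else 0) /
      max (∑ i, if d i = true then 1 else 0) 1 * delta dhat n x d =
    (∑ i ∈ Finset.univ.filter (fun i => dt i = true), (1 - q i dt)) /
      ((Finset.univ.filter fun i => dt i = true).card : ℝ≥0∞) := by
  have h1 : (1 : ℝ≥0∞) ≤ ((Finset.univ.filter fun i => dt i = true).card : ℝ≥0∞) := by
    exact_mod_cast hne.card_pos
  rw [Finset.sum_eq_single dt]
  · rw [delta, if_pos hx, mul_one, ← Finset.sum_filter, ← Finset.sum_filter, Finset.sum_const,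
      nsmul_eq_mul, mul_one, max_eq_left h1]
  · intro d _ hd
    rw [delta, if_neg (fun h => hd (h.symm.trans hx)), mul_zero]
  · exact fun h => absurd (Finset.mem_univ dt) h

variable {Ω Ξ : Type*} [MeasurableSpace Ω] [MeasurableSpace Ξ] [MeasurableSpace (∀ k, S k)]
  {B : BayesModel Ω Ξ (∀ k, S k)}

lemma measurableSet_hyp (hΘ₀ : ∀ i, MeasurableSet {θ : ∀ k, S k | θ (e i) ∈ Θ₀ i})
    (i : Fin m) (b : Bool) : MeasurableSet (hyp e Θ₀ i b) := by
  cases b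
  · exact hΘ₀ i
  · exact (hΘ₀ i).compl

lemma measurableSet_configSet (hΘ₀ : ∀ i, MeasurableSet {θ : ∀ k, S k | θ (e i) ∈ Θ₀ i})
    (d : Fin m → Bool) : MeasurableSet (configSet e Θ₀ d) := by
  rw [configSet, Set.ofPred_forall]
  exact MeasurableSet.iInter fun i => measurableSet_hyp hΘ₀ i (d i)

lemma measurableSet_groupSet (hΘ₀ : ∀ i, MeasurableSet {θ : ∀ k, S k | θ (e i) ∈ Θ₀ i})
    (Gr : Fin m → Finset (Fin m)) (i : Fin m) (d : Fin m → Bool) :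
    MeasurableSet (groupSet e Θ₀ Gr i d) := by
  have h : groupSet e Θ₀ Gr i d =
      hyp e Θ₀ i true ∩ ⋂ j, ⋂ (_ : j ∈ Gr i), ⋂ (_ : j ≠ i), hyp e Θ₀ j (d j) := by
    ext θ
    simp [groupSet]
  rw [h]
  exact (measurableSet_hyp hΘ₀ i true).inter (MeasurableSet.iInter fun j =>
    MeasurableSet.iInter fun _ => MeasurableSet.iInter fun _ => measurableSet_hyp hΘ₀ j (d j))

/-- Every set of parameters on which the true configuration is wrong is at positive divergence,
being covered by the finitely many other configurations. -/
lemma IsTrueConfig.JSet_pos (hdt : B.IsTrueConfig e Θ₀ dt) {a : ℝ} (ha : B.hSet Set.univ = a)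
    (hΘ₀ : ∀ i, MeasurableSet {θ : ∀ k, S k | θ (e i) ∈ Θ₀ i}) {A : Set (∀ k, S k)}
    (hA : MeasurableSet A) (hAdt : A ⊆ (configSet e Θ₀ dt)ᶜ) : 0 < B.JSet A := by
  have huniv : B.JSet Set.univ = 0 := by
    rw [JSet_eq ha, ha, ← EReal.coe_sub, sub_self, EReal.coe_zero]
  have hpos : 0 < (Finset.univ.erase dt).inf fun d => B.JSet (configSet e Θ₀ d) := by
    refine (Finset.lt_inf_iff EReal.zero_lt_top).2 fun d hd => ?_
    rw [← huniv]
    exact hdt.2 d (Finset.ne_of_mem_erase hd)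
  refine hpos.trans_le (le_essInf_iff_ae.2 ((ae_restrict_iff' hA).2 ?_))
  have hall : ∀ᵐ θ ∂B.prior, ∀ d, θ ∈ configSet e Θ₀ d → B.JSet (configSet e Θ₀ d) ≤ B.J θ :=
    ae_all_iff.2 fun d =>
      (ae_restrict_iff' (measurableSet_configSet hΘ₀ d)).1 (le_essInf_iff_ae.1 le_rfl)
  filter_upwards [hall] with θ hθ hθA
  classical
  let d : Fin m → Bool := fun i => decide (θ (e i) ∉ Θ₀ i)
  have hd : θ ∈ configSet e Θ₀ d := fun i => mem_hyp_iff.2 decide_eq_true_iff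
  have hne : d ≠ dt := fun h => hAdt hθA (h ▸ hd)
  exact (Finset.inf_le (Finset.mem_erase.2 ⟨hne, Finset.mem_univ d⟩)).trans (hθ d hd)

/-! ### Consistency of the non-marginal procedure -/

/-- If the posterior probabilities `w_i` are within `ε` of the truth and `ε` is small compared to
the distance of `β` from `0` and `1`, then only the true configuration maximizes the criterion:
relative to `dt`, each wrong decision loses at least `c - ε` and each right one gains at most
`ε`. -/
lemma eq_of_criterion_le {Gr : Fin m → Finset (Fin m)} {b c ε : ℝ} {n : ℕ} {x : Fin n → Ξ}
    (hcb : c ≤ b) (hcb' : c ≤ 1 - b) (hε0 : 0 ≤ ε) (hεc : m * ε < c)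
    (htrue : ∀ i, dt i = true → 1 - ε ≤ (B.w e Θ₀ Gr n x i dt).toReal)
    (hfalse : ∀ i, dt i = false → ∀ d, (B.w e Θ₀ Gr n x i d).toReal ≤ ε) {d : Fin m → Bool}
    (hd : B.criterion e Θ₀ Gr b n x dt ≤ B.criterion e Θ₀ Gr b n x d) : d = dt := by
  by_contra hne
  obtain ⟨i₀, hi₀⟩ := Function.ne_iff.1 hne
  have hc0 : 0 ≤ c := (by positivity : 0 ≤ m * ε).trans hεc.le
  have hterm : ∀ i, (if d i = true then (B.w e Θ₀ Gr n x i d).toReal - b else 0) +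
      (if d i ≠ dt i then c else 0) ≤
      (if dt i = true then (B.w e Θ₀ Gr n x i dt).toReal - b else 0) + ε := by
    intro i
    have h1 : (B.w e Θ₀ Gr n x i d).toReal ≤ 1 :=
      ENNReal.toReal_mono ENNReal.one_ne_top (post_le_one _ _ _)
    cases hdi : d i <;> cases hdti : dt i
    · simpa using hε0
    · have := htrue i hdti
      simp; linarith
    · have := hfalse i hdti d
      simp; linarith
    · have := htrue i hdti
      simp; linarith
  have hsum := Finset.sum_le_sum fun i (_ : i ∈ Finset.univ) => hterm i
  rw [Finset.sum_add_distrib, Finset.sum_add_distrib] at hsum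
  have hc : c ≤ ∑ i, if d i ≠ dt i then c else 0 := by
    calc c = if d i₀ ≠ dt i₀ then c else 0 := by rw [if_pos hi₀]
      _ ≤ _ := Finset.single_le_sum (f := fun i => if d i ≠ dt i then c else 0)
        (fun i _ => by split_ifs <;> simp [hc0]) (Finset.mem_univ i₀)
  simp only [Finset.sum_const, Finset.card_univ, Fintype.card_fin, nsmul_eq_mul] at hsum
  simp only [criterion] at hd
  linarith

/-- At regular sample points the non-marginal procedure eventually takes the true decisions. -/
theorem IsRegularPoint.eventually_dhat_eq {G : ℕ → Set (∀ k, S k)} {ς : ℝ}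
    (hS : B.ShaliziConditions G ς) {ω : Ω} (hω : B.IsRegularPoint G ς ω)
    (hΘ₀ : ∀ i, MeasurableSet {θ : ∀ k, S k | θ (e i) ∈ Θ₀ i})
    (hdt : B.IsTrueConfig e Θ₀ dt) {Gr : Fin m → Finset (Fin m)} {β : ℕ → ℝ}
    (hβ : ∀ n, 0 < β n ∧ β n < 1) (hinf : 0 < liminf β atTop) (hsup : limsup β atTop < 1)
    {dhat : (n : ℕ) → (Fin n → Ξ) → (Fin m → Bool)} (hdhat : B.IsNonMarginal e Θ₀ Gr β dhat) :
    ∀ᶠ n in atTop, dhat n (B.data n ω) = dt := by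
  obtain ⟨a, -, ha⟩ := hS.exists_hSet_univ_eq
  obtain ⟨c₁, hc₁, hc₁'⟩ := exists_between hinf
  obtain ⟨c₂, hc₂, hc₂'⟩ := exists_between hsup
  have hβ₁ : ∀ᶠ n in atTop, c₁ < β n := eventually_lt_of_lt_liminf hc₁'
    (isBoundedUnder_of ⟨0, fun n => (hβ n).1.le⟩)
  have hβ₂ : ∀ᶠ n in atTop, β n < c₂ := eventually_lt_of_limsup_lt hc₂
    (isBoundedUnder_of ⟨1, fun n => (hβ n).2.le⟩)
  set c := min c₁ (1 - c₂) with hc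
  have hc0 : 0 < c := lt_min hc₁ (sub_pos.2 hc₂')
  -- with `m` decisions the total gain is at most `m * ε`, which has to stay below `c`
  set ε := c / (m + 1) with hε
  have hε0 : 0 < ε := by positivity
  have hεc : m * ε < c := by
    have : (m + 1) * ε = c := by rw [hε]; field_simp
    linarith
  have hε' : 0 < ENNReal.ofReal ε := ENNReal.ofReal_pos.2 hε0
  have htrue : ∀ᶠ n in atTop, ∀ i, dt i = true →
      B.post n (B.data n ω) (groupSet e Θ₀ Gr i dt)ᶜ ≤ ENNReal.ofReal ε :=
    eventually_all.2 fun i => eventually_imp_distrib_left.2 fun hi =>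
      hω.eventually_post_le_const hS (measurableSet_groupSet hΘ₀ Gr i dt).compl
        (hdt.JSet_pos ha hΘ₀ (measurableSet_groupSet hΘ₀ Gr i dt).compl
          (Set.compl_subset_compl.2 (configSet_subset_groupSet Gr hi))) hε'
  have hfalse : ∀ᶠ n in atTop, ∀ i, dt i = false →
      B.post n (B.data n ω) (hyp e Θ₀ i true) ≤ ENNReal.ofReal ε :=
    eventually_all.2 fun i => eventually_imp_distrib_left.2 fun hi =>
      hω.eventually_post_le_const hS (measurableSet_hyp hΘ₀ i true)
        (hdt.JSet_pos ha hΘ₀ (measurableSet_hyp hΘ₀ i true) (by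
          rw [Set.subset_compl_comm, compl_hyp]
          intro θ hθ
          have h := hθ i
          rwa [hi] at h)) hε'
  filter_upwards [hβ₁, hβ₂, htrue, hfalse, hω.eventually_one_sub_post hS] with n h1 h2 h3 h4 h5
  refine eq_of_criterion_le (ε := ε) ((min_le_left _ _).trans h1.le)
    ((min_le_right _ _).trans (by linarith)) hε0.le hεc (fun i hi => ?_) (fun i hi d => ?_)
    (hdhat n (B.data n ω) dt)
  · have h := h3 i hi
    rw [← h5 _ (measurableSet_groupSet hΘ₀ Gr i dt)] at h
    have h' := ENNReal.toReal_mono ENNReal.ofReal_ne_top h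
    rw [ENNReal.toReal_ofReal hε0.le,
      ENNReal.toReal_sub_of_le (post_le_one _ _ _) ENNReal.one_ne_top, ENNReal.toReal_one] at h'
    rw [w]
    linarith
  · exact ENNReal.toReal_le_of_le_ofReal hε0.le
      ((post_mono _ _ (groupSet_subset_hyp Gr i d)).trans (h4 i hi))

end Testing

end BayesModel

theorem mainTheorem2 {Ω Ξ κ : Type*} {S : κ → Type*} [MeasurableSpace Ω] [MeasurableSpace Ξ]
    [MeasurableSpace (∀ k, S k)] (B : BayesModel Ω Ξ (∀ k, S k))
    -- standing assumptions (S1)-(S7)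
    (G : ℕ → Set (∀ k, S k)) (ς : ℝ) (hS : B.ShaliziConditions G ς)
    -- the hypotheses, their groups and the true decision configuration
    {m : ℕ} (e : Fin m ↪ κ) (Θ₀ : (i : Fin m) → Set (S (e i)))
    (hΘ₀ : ∀ i, MeasurableSet {θ : ∀ k, S k | θ (e i) ∈ Θ₀ i})
    (Gr : Fin m → Finset (Fin m)) (hGr : ∀ i, i ∈ Gr i)
    (dt : Fin m → Bool) (hdt : B.IsTrueConfig e Θ₀ dt)
    -- the exponent condition of the posterior convergence theorem
    (hς : ∃ i, dt i = true ∧ 2 * B.hSet (BayesModel.hyp e Θ₀ i false) < (ς : EReal))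
    -- (A1)
    (β : ℕ → ℝ) (hβ : ∀ n, 0 < β n ∧ β n < 1)
    (hA1_inf : 0 < liminf β atTop) (hA1_sup : limsup β atTop < 1)
    -- (A2)
    (hA2_zero : dt ≠ fun _ => false) (hA2_one : dt ≠ fun _ => true)
    -- the non-marginal procedure
    (dhat : (n : ℕ) → (Fin n → Ξ) → (Fin m → Bool))
    (hdhat : B.IsNonMarginal e Θ₀ Gr β dhat) :
    ∀ᵐ ω ∂B.P,
      Tendsto (fun n : ℕ => ENNReal.log (B.mFDR e Θ₀ Gr dhat n (B.data n ω)) / (n : EReal))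
        atTop (𝓝 (-(B.Jmin e Θ₀ Gr dt))) ∧
      Tendsto (fun n : ℕ => ENNReal.log (B.FDR e Θ₀ dhat n (B.data n ω)) / (n : EReal))
        atTop (𝓝 (-(B.Hmin e Θ₀ dt))) := by
  obtain ⟨a, haς, ha⟩ := hS.exists_hSet_univ_eq
  obtain ⟨i₁, hi₁, hi₁ς⟩ := hς
  have hmem : i₁ ∈ Finset.univ.filter fun i => dt i = true := by simpa using hi₁
  -- `2 h(H₀ᵢ) < ς` and `h(Θ) ≤ h(H₀ᵢ)` give `J(H₀ᵢ) < ς - h(Θ)`: the rate `J(H₀ᵢ)` is less than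
  -- the one at which the complement of the sieve loses posterior mass.
  have hJ : B.JSet (BayesModel.hyp e Θ₀ i₁ false) < ((ς - a : ℝ) : EReal) := by
    rw [BayesModel.JSet_lt_iff ha, sub_add_cancel]
    refine lt_of_le_of_lt ?_ hi₁ς
    exact le_mul_of_one_le_left (BayesModel.hSet_nonneg _) one_le_two
  have hcompl : ∀ i, (BayesModel.hyp e Θ₀ i true)ᶜ = BayesModel.hyp e Θ₀ i false :=
    fun i => BayesModel.compl_hyp i true
  have hJ' : B.JSet (BayesModel.groupSet e Θ₀ Gr i₁ dt)ᶜ < ((ς - a : ℝ) : EReal) := by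
    refine lt_of_le_of_lt ?_ hJ
    rw [BayesModel.JSet_eq ha, BayesModel.JSet_eq ha]
    refine EReal.sub_le_sub (BayesModel.hSet_anti ?_) le_rfl
    rw [← hcompl]
    exact Set.compl_subset_compl.2 (BayesModel.groupSet_subset_hyp Gr i₁ dt)
  filter_upwards [hS.ae_isRegularPoint] with ω hω
  have hdec := hω.eventually_dhat_eq hS hΘ₀ hdt hβ hA1_inf hA1_sup hdhat
  have hcompl_post := hω.eventually_one_sub_post hS
  refine ⟨hω.tendsto_log_average_post hS ha ⟨i₁, hmem⟩
      (A := fun i => (BayesModel.groupSet e Θ₀ Gr i dt)ᶜ)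
      (fun i => (BayesModel.measurableSet_groupSet hΘ₀ Gr i dt).compl)
      ((Finset.inf_le hmem).trans_lt hJ') ?_,
    hω.tendsto_log_average_post hS ha ⟨i₁, hmem⟩ (A := fun i => BayesModel.hyp e Θ₀ i false)
      (fun i => BayesModel.measurableSet_hyp hΘ₀ i false)
      ((Finset.inf_le hmem).trans_lt hJ) ?_⟩
  · filter_upwards [hdec, hcompl_post] with n hn hpost
    refine (BayesModel.sum_errorRate_mul_delta hn ⟨i₁, hmem⟩
      fun i d => B.w e Θ₀ Gr n (B.data n ω) i d).trans ?_
    simp only [BayesModel.w, hpost _ (BayesModel.measurableSet_groupSet hΘ₀ Gr _ dt)]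
  · filter_upwards [hdec, hcompl_post] with n hn hpost
    refine (BayesModel.sum_errorRate_mul_delta hn ⟨i₁, hmem⟩
      fun i _ => B.v e Θ₀ n (B.data n ω) i).trans ?_
    simp only [BayesModel.v, hpost _ (BayesModel.measurableSet_hyp hΘ₀ _ true), hcompl]
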